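/- A polynomial $F\in\mathbb{C}[x,y,z,t]$ is called Cartesian if $F=G(x,y)F_1(x,y,z,t)+H(z,t)F_2(x,y,z,t)$ for some non-constant polynomials $G\in\mathbb{C}[x,y]$, $H\in\mathbb{C}[z,t]$ and some $F_1,F_2\in\mathbb{C}[x,y,z,t]$; otherwise it is called non-Cartesian. Let $\mathcal{P}_d$ be the affine space of all polynomials in $\mathbb{C}[x,y,z,t]$ of degree at most $d$, with the coefficients as coordinates. A property is said to hold for a generic polynomial of degree $d$ if it holds for all members of some nonempty Zariski-open subset of $\mathcal{P}_d$. Let $d\ge 2$. 1. A generic polynomial $F$ of degree $d$ is non-Cartesian and, moreover, has the following property: for every polynomial $G\in\mathbb{C}[x,y,z,t]$ of degree at most $d$, the set $\{a\in\mathbb{C}: F+aG \text{ is Cartesian}\}$ is finite. (The Zariski-open set of polynomials $F$ does not depend on $G$.) 2. For every polynomial $G\in\mathbb{C}[x,y,z,t]$, of any degree, the set $\{a\in\mathbb{C}: F+aG \text{ is Cartesian}\}$ is finite for a generic polynomial $F$ of degree $d$. (Here the Zariski-open set of polynomials $F$ may depend on $G$.) -/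

import Mathlib

/-- A polynomial `F(x, y, z, t)` over `ℂ` (the variables `x, y, z, t` have the indices
`0, 1, 2, 3`) is Cartesian if `F = G(x, y) * F₁(x, y, z, t) + H(z, t) * F₂(x, y, z, t)` for some
non-constant polynomials `G`, `H` in two variables and some polynomials `F₁`, `F₂`. -/
def IsCartesian (F : MvPolynomial (Fin 4) ℂ) : Prop :=
  ∃ (G H : MvPolynomial (Fin 2) ℂ) (F₁ F₂ : MvPolynomial (Fin 4) ℂ),
    (∀ c : ℂ, G ≠ MvPolynomial.C c) ∧ (∀ c : ℂ, H ≠ MvPolynomial.C c) ∧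
      F = MvPolynomial.rename ![0, 1] G * F₁ + MvPolynomial.rename ![2, 3] H * F₂

/-- The monomials of degree at most `d` in four variables: the index set of the coordinates on
the affine space of polynomials of degree at most `d`. -/
abbrev CoeffIndex (d : ℕ) : Type := {m : Fin 4 →₀ ℕ // m.degree ≤ d}

/-- The coefficient vector of `F`, i.e. the coordinates of `F` in the affine space of polynomials
of degree at most `d`. -/
def coeffVector (d : ℕ) (F : MvPolynomial (Fin 4) ℂ) : CoeffIndex d → ℂ :=
  fun m => MvPolynomial.coeff m.1 F

/-- `U` is a Zariski-open subset of the affine space of all polynomials of degree at most `d` in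
four variables: the complement there of the common zero locus of a set `S` of polynomials in the
coefficients. -/
def IsZariskiOpen (d : ℕ) (U : Set (MvPolynomial (Fin 4) ℂ)) : Prop :=
  ∃ S : Set (MvPolynomial (CoeffIndex d) ℂ),
    U = {F | F.totalDegree ≤ d ∧ ¬ ∀ Φ ∈ S, MvPolynomial.eval (coeffVector d F) Φ = 0}

/-- The property `P` holds for a (Zariski) generic polynomial of degree `d` in four variables: it
holds on a nonempty Zariski-open subset of the affine space of polynomials of degree at
most `d`. That space is irreducible, so nonempty open subsets are dense. -/
def HoldsGenerically (d : ℕ) (P : MvPolynomial (Fin 4) ℂ → Prop) : Prop :=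
  ∃ U : Set (MvPolynomial (Fin 4) ℂ), IsZariskiOpen d U ∧ U.Nonempty ∧ ∀ F ∈ U, P F

/-! The proof is a dimension count. If `F + a G` is Cartesian, it vanishes on a product K × L, each
factor being a plane curve or the whole plane (`IsCartesian.exists_product`), hence on the nine
pairs formed by three points of K and three of L. Such triples can be chosen from finitely many
families, with one parameter on a horizontal line, two on another line, and three when the points
are not collinear (`exists_finite_paramTriple`). Two noncollinear triples give six parameters
against nine independent linear conditions on `F`; in every other case there are at most five
parameters against six conditions (`exists_relation_of_vanishing_on_grid`). Hence the bad pairs (F,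
a) satisfy a single nonzero relation Ψ.

If the leading coefficient of Ψ in `a` is nonzero at `F`, only finitely many `a` are bad, which is
part 2. For part 1 take `G = 0`: the Cartesian polynomials of degree at most `d` lie in the zero
locus of a nonzero Φ that does not depend on `G`, and a line F + aG starting off this locus meets it
finitely often. -/

open MvPolynomial

/-! ### Algebraic dependence and the parameter count -/

/-- A family of more rational functions `f i / D` than there are variables satisfies a nontrivial
polynomial relation. -/
theorem exists_relation_of_card_lt {σ τ : Type} [Fintype σ] [Fintype τ]
    (h : Fintype.card σ < Fintype.card τ) (f : τ → MvPolynomial σ ℂ) (D : MvPolynomial σ ℂ)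
    (hD : D ≠ 0) :
    ∃ Ψ : MvPolynomial τ ℂ, Ψ ≠ 0 ∧ ∀ (s : σ → ℂ) (y : τ → ℂ), eval s D ≠ 0 →
      (∀ i, eval s D * y i = eval s (f i)) → eval y Ψ = 0 := by
  classical
  let A := Localization.Away D
  have hle : Submonoid.powers D ≤ nonZeroDivisors (MvPolynomial σ ℂ) :=
    powers_le_nonZeroDivisors_of_noZeroDivisors hD
  have : IsDomain A := IsLocalization.isDomain_of_le_nonZeroDivisors _ hle
  have hinj : Function.Injective (algebraMap (MvPolynomial σ ℂ) A) := IsLocalization.injective A hle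
  have : FaithfulSMul (MvPolynomial σ ℂ) A := (faithfulSMul_iff_algebraMap_injective _ _).2 hinj
  have : Algebra.IsAlgebraic (MvPolynomial σ ℂ) A :=
    IsLocalization.isAlgebraic _ (Submonoid.powers D)
  -- Inverting `D` is an algebraic extension, so the transcendence degree remains the number of
  -- variables.
  have htr : Algebra.trdeg ℂ A = Fintype.card σ := by
    rw [← _root_.trdeg_add_eq ℂ (MvPolynomial σ ℂ) (A := A), MvPolynomial.trdeg_of_isDomain,
      trdeg_eq_zero (R := MvPolynomial σ ℂ) (A := A)]
    simp
  let g : τ → A := fun i => IsLocalization.mk' A (f i) (⟨D, 1, by simp⟩ : Submonoid.powers D)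
  have hdep : ¬ AlgebraicIndependent ℂ g := by
    intro hi
    have := hi.cardinalMk_le_trdeg
    rw [htr, Cardinal.mk_fintype, Nat.cast_le] at this
    omega
  rw [algebraicIndependent_iff] at hdep
  push Not at hdep
  obtain ⟨Ψ, h0, hne⟩ := hdep
  refine ⟨Ψ, hne, fun s y hs hy => ?_⟩
  let φ : A →+* ℂ := IsLocalization.Away.lift (S := A) D (g := eval s) (IsUnit.mk0 _ hs)
  have hφ : ∀ p, φ (algebraMap _ A p) = eval s p :=
    fun p => IsLocalization.Away.lift_eq (S := A) D (IsUnit.mk0 _ hs) p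
  have hg : ∀ i, φ (g i) = y i := by
    intro i
    have h1 : algebraMap _ A D * g i = algebraMap _ A (f i) := by
      simpa [g] using IsLocalization.mk'_spec' A (f i) (⟨D, 1, by simp⟩ : Submonoid.powers D)
    have h2 := congrArg φ h1
    rw [map_mul, hφ, hφ, ← hy] at h2
    exact mul_left_cancel₀ hs h2
  have h3 := congrArg φ h0
  rw [map_zero, aeval_def, hom_eval₂] at h3

  have h4 : φ.comp (algebraMap ℂ A) = RingHom.id ℂ := by
    ext c
    simp [IsScalarTower.algebraMap_apply ℂ (MvPolynomial σ ℂ) A, hφ, algebraMap_eq]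
  rw [h4] at h3
  have h5 : (fun i => φ (g i)) = y := funext hg
  rw [← h5]
  exact h3

noncomputable instance (d : ℕ) : Fintype (CoeffIndex d) :=
  (Finsupp.finite_of_degree_le d).fintype

theorem eval_eq_sum_coeffVector {d : ℕ} {F : MvPolynomial (Fin 4) ℂ} (hF : F.totalDegree ≤ d)
    (p : Fin 4 → ℂ) :
    eval p F = ∑ m : CoeffIndex d, coeffVector d F m * ∏ l, p l ^ m.1 l := by
  classical
  rw [eval_eq']
  have h1 : ∀ m ∈ F.support, m.degree ≤ d := fun m hm =>
    (le_totalDegree (p := F) hm).trans hF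
  symm
  rw [← Finset.sum_coe_sort F.support]
  refine (Finset.sum_of_injOn (fun m : F.support => (⟨m.1, h1 m.1 m.2⟩ : CoeffIndex d))
    (fun a _ b _ hab => Subtype.ext (congrArg (fun m : CoeffIndex d => m.1) hab)) (by simp) ?_ (by simp [coeffVector])).symm
  intro m _ hm
  have h2 : m.1 ∉ F.support := fun h => hm ⟨⟨m.1, h⟩, by simp, rfl⟩
  rw [coeffVector, notMem_support_iff.1 h2, zero_mul]

theorem eval_aeval {σ τ : Type} (s : σ → ℂ) (P : τ → MvPolynomial σ ℂ) (G : MvPolynomial τ ℂ) :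
    eval s (aeval P G) = eval (fun l => eval s (P l)) G := by
  induction G using MvPolynomial.induction_on with
  | C c => simp [algebraMap_eq]
  | add p q hp hq => simp only [map_add, hp, hq]
  | mul_X p i hp => simp only [map_mul, hp, aeval_X, eval_X]

/-- If `F + a G` vanishes at more points than the number of parameters on which these points depend,
and `F` has sufficiently many coefficients which are determined by the values at these points, then
the coefficients of `F` and the number `a` satisfy a nontrivial polynomial relation. -/
theorem exists_relation_of_det_ne_zero {d : ℕ} {ι ρ : Type} [Fintype ι] [Fintype ρ]
    [DecidableEq ρ] (hcard : Fintype.card ι < Fintype.card ρ) (S : ρ → CoeffIndex d)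
    (hS : Function.Injective S) (P : ρ → Fin 4 → MvPolynomial ι ℂ) (G : MvPolynomial (Fin 4) ℂ) :
    ∃ Ψ : MvPolynomial (Option (CoeffIndex d)) ℂ, Ψ ≠ 0 ∧
      ∀ (F : MvPolynomial (Fin 4) ℂ) (a : ℂ) (s : ι → ℂ), F.totalDegree ≤ d →
        (Matrix.of fun i j => ∏ l, eval s (P i l) ^ (S j).1 l).det ≠ 0 →
        (∀ i, eval (fun l => eval s (P i l)) (F + C a * G) = 0) →
        eval (fun o => o.elim a (coeffVector d F)) Ψ = 0 := by
  classical
  let M₀ : Matrix ρ ρ (MvPolynomial ι ℂ) := Matrix.of fun i j => ∏ l, P i l ^ (S j).1 l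
  have hM₀ : ∀ s : ι → ℂ, eval s M₀.det =
      (Matrix.of fun i j => ∏ l, eval s (P i l) ^ (S j).1 l).det := by
    intro s
    rw [RingHom.map_det]
    congr 1
    ext i j
    simp [M₀]
  -- If the determinant vanishes identically, no `s` meets the hypothesis and any nonzero `Ψ` will
  -- do.
  by_cases hD₀ : M₀.det = 0
  · refine ⟨1, one_ne_zero, fun F a s _ hs => ?_⟩
    rw [← hM₀, hD₀, map_zero] at hs
    exact absurd rfl hs
  let R : Set (Option (CoeffIndex d)) := Set.range (fun j => some (S j))
  have hRinj : Function.Injective (fun j => some (S j)) := (Option.some_injective _).comp hS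
  -- The free data are the parameters and all coordinates of (F, a) outside `R`; those in `R` are
  -- recovered by Cramer's rule. `X'` puts zero in their place, so `E i` is the part of the `i`-th
  -- condition not involving them.
  let σ := ι ⊕ {t // t ∉ R}
  let X' : Option (CoeffIndex d) → MvPolynomial σ ℂ := fun t =>
    if h : t ∉ R then X (Sum.inr ⟨t, h⟩) else 0
  let r : MvPolynomial ι ℂ →ₐ[ℂ] MvPolynomial σ ℂ := rename Sum.inl
  let E : ρ → MvPolynomial σ ℂ := fun i =>
    r (aeval (P i) G) * X' none + ∑ m : CoeffIndex d, X' (some m) * r (∏ l, P i l ^ m.1 l)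
  let M : Matrix ρ ρ (MvPolynomial σ ℂ) := r.mapMatrix M₀
  let f : Option (CoeffIndex d) → MvPolynomial σ ℂ := fun t =>
    if h : t ∈ R then -(M.adjugate.mulVec E) h.choose else M.det * X' t
  have hMdet : M.det = r M₀.det := (AlgHom.map_det r M₀).symm
  have hD : M.det ≠ 0 := by
    rw [hMdet]
    exact fun h => hD₀ (rename_injective _ Sum.inl_injective (h.trans (map_zero r).symm))
  have hσ : Fintype.card σ < Fintype.card (Option (CoeffIndex d)) := by
    have h1 : Fintype.card {t // t ∈ R} = Fintype.card ρ :=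
      Set.card_range_of_injective hRinj
    have h2 := Fintype.card_subtype_compl (fun t => t ∈ R)
    have h3 := Fintype.card_subtype_le (fun t => t ∈ R)
    rw [Fintype.card_sum, h2]
    omega
  obtain ⟨Ψ, hΨ, hrel⟩ := exists_relation_of_card_lt hσ f M.det hD
  refine ⟨Ψ, hΨ, fun F a s hF hs hP => ?_⟩
  set y : Option (CoeffIndex d) → ℂ := fun o => o.elim a (coeffVector d F) with hy
  let v : σ → ℂ := Sum.elim s fun t => y t
  have hr : ∀ p, eval v (r p) = eval s p := fun p => by
    simp only [r, eval_rename]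
    rfl
  have hX' : ∀ t, eval v (X' t) = if t ∈ R then 0 else y t := by
    intro t
    by_cases h : t ∈ R <;> simp [X', h, v]
  refine hrel v y (by rwa [hMdet, hr, hM₀]) fun t => ?_
  by_cases ht : t ∈ R
  swap
  · simp [f, ht, hX']
  obtain ⟨j, hj⟩ : ∃ j, ht.choose = j := ⟨_, rfl⟩
  have hjt : some (S j) = t := hj ▸ ht.choose_spec
  have hft : f t = -(M.adjugate.mulVec E) j := by
    simp only [f, dif_pos ht, hj]
  let w : ρ → ℂ := fun j => y (some (S j))
  let N : Matrix ρ ρ ℂ := (eval v).mapMatrix M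
  have hN : ∀ i j, N i j = ∏ l, eval s (P i l) ^ (S j).1 l := by
    intro i j
    change eval v (r (M₀ i j)) = _
    rw [hr]
    simp [M₀]
  have hNw : N.mulVec w = -fun i => eval v (E i) := by
    funext i
    have h1 := hP i
    rw [map_add, eval_eq_sum_coeffVector hF, map_mul, eval_C] at h1
    have h2 : eval v (E i) = eval (fun l => eval s (P i l)) G * a +
        ∑ m : CoeffIndex d, (if some m ∈ R then 0 else coeffVector d F m) *
          ∏ l, eval s (P i l) ^ m.1 l := by
      have h0 : none ∉ R := by rintro ⟨j, hj⟩; cases hj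
      simp only [E, map_add, map_mul, map_sum, hr, hX', if_neg h0, map_prod, map_pow]
      congr 2
      exact eval_aeval s (P i) G
    have h3 : N.mulVec w i = ∑ m : CoeffIndex d, (if some m ∈ R then coeffVector d F m else 0) *
          ∏ l, eval s (P i l) ^ m.1 l := by
      simp only [Matrix.mulVec, dotProduct, hN, w]
      have hmem : ∀ m : CoeffIndex d, some m ∈ R ↔ m ∈ Finset.univ.image S := by
        intro m
        simp [R]
      simp only [hmem, ite_mul, zero_mul]
      rw [Finset.sum_ite_mem, Finset.univ_inter, Finset.sum_image hS.injOn]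
      exact Finset.sum_congr rfl fun j _ => mul_comm _ _
    have h4 : ∑ m : CoeffIndex d, coeffVector d F m * ∏ l, eval s (P i l) ^ m.1 l =
        N.mulVec w i + ∑ m : CoeffIndex d, (if some m ∈ R then 0 else coeffVector d F m) *
          ∏ l, eval s (P i l) ^ m.1 l := by
      rw [h3, ← Finset.sum_add_distrib]
      refine Finset.sum_congr rfl fun m _ => ?_
      split_ifs <;> ring
    rw [Pi.neg_apply, h2]
    linear_combination h1 - h4
  -- Cramer's rule in adjugate form, avoiding division.
  have hkey : N.det • w = -(N.adjugate.mulVec fun i => eval v (E i)) := by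
    rw [← Matrix.mulVec_neg, ← hNw, Matrix.mulVec_mulVec, Matrix.adjugate_mul, Matrix.smul_mulVec,
      Matrix.one_mulVec]
  have hadj : ∀ i j, eval v (M.adjugate i j) = N.adjugate i j := by
    intro i j
    rw [← RingHom.map_adjugate]
    rfl
  have := congrFun hkey j
  rw [hft, map_neg, RingHom.map_det, ← hjt]
  refine this.trans ?_
  simp only [Pi.neg_apply, Matrix.mulVec, dotProduct, map_sum, map_mul, hadj]

/-! ### Plane curves and horizontal lines -/

/-- A set in the affine plane which either contains a horizontal line, or meets all horizontal
lines but at most `e`. -/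
def MeetsHorizontalLines (e : ℕ) (K : Set (Fin 2 → ℂ)) : Prop :=
  (∃ y, ∀ x, ![x, y] ∈ K) ∨ ∃ T : Finset ℂ, T.card ≤ e ∧ ∀ y, y ∉ T → ∃ x, ![x, y] ∈ K

theorem meetsHorizontalLines_univ (e : ℕ) : MeetsHorizontalLines e Set.univ :=
  Or.inl ⟨0, fun _ => trivial⟩

theorem exists_eval_eq_zero {g : MvPolynomial (Fin 2) ℂ} (hg : ∀ c : ℂ, g ≠ C c) :
    (∃ y, ∀ x, eval ![x, y] g = 0) ∨ ∃ T : Finset ℂ, T.card ≤ g.totalDegree ∧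
      ∀ y, y ∉ T → ∃ x, eval ![x, y] g = 0 := by
  classical
  have hg0 : g ≠ 0 := by simpa using hg 0
  let p := finSuccEquiv ℂ 1 g
  have hp0 : p ≠ 0 := by simpa [p] using hg0
  -- `q` is the leading coefficient of `g` in x, as a polynomial in y. If `g` has positive degree in
  -- x, only the roots of `q` can be exceptional heights; otherwise `g` equals `q` and a root gives
  -- a horizontal line.
  let q : Polynomial ℂ := aeval (fun _ => Polynomial.X) p.leadingCoeff
  have hq : ∀ y, q.eval y = eval (fun _ => y) p.leadingCoeff := by
    intro y
    simp only [q]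
    generalize p.leadingCoeff = r
    induction r using MvPolynomial.induction_on with
    | C c => simp
    | add p q hp hq => simp only [map_add, Polynomial.eval_add, hp, hq]
    | mul_X p i hp => simp only [map_mul, Polynomial.eval_mul, hp, aeval_X, eval_X,
        Polynomial.eval_X]
  have heval : ∀ x y, eval ![x, y] g = (p.map (eval fun _ => y)).eval x := by
    intro x y
    have h : (![x, y] : Fin 2 → ℂ) = Fin.cons x fun _ => y := by
      ext i
      fin_cases i <;> rfl
    rw [h, eval_eq_eval_mv_eval']
  have hfun : ∀ v : Fin 1 → ℂ, v = fun _ => v 0 := fun v => by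
    ext i
    rw [Subsingleton.elim i 0]
  have hq0 : q ≠ 0 := by
    intro h
    refine Polynomial.leadingCoeff_ne_zero.2 hp0 (MvPolynomial.funext fun v => ?_)
    rw [hfun v, ← hq, h]
    simp
  by_cases hdeg : p.natDegree = 0
  · left
    have hpC : p = Polynomial.C p.leadingCoeff := by
      rw [Polynomial.leadingCoeff, hdeg]
      exact Polynomial.eq_C_of_natDegree_eq_zero hdeg
    have hev : ∀ x y, eval ![x, y] g = q.eval y := by
      intro x y
      rw [heval, hpC, Polynomial.map_C, Polynomial.eval_C, hq]
    have hqdeg : q.degree ≠ 0 := by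
      intro h
      obtain ⟨c, hc⟩ : ∃ c, q = Polynomial.C c := ⟨_, Polynomial.eq_C_of_degree_eq_zero h⟩
      refine hg c (MvPolynomial.funext fun v => ?_)
      have hv : v = ![v 0, v 1] := by
        ext i
        fin_cases i <;> rfl
      rw [hv, hev, hc]
      simp
    obtain ⟨y, hy⟩ := IsAlgClosed.exists_root q hqdeg
    exact ⟨y, fun x => by rw [hev]; exact hy⟩
  · right
    refine ⟨q.roots.toFinset, ?_, fun y hy => ?_⟩
    · refine (Multiset.toFinset_card_le _).trans ((Polynomial.card_roots' q).trans ?_)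
      have h1 : q.natDegree ≤ p.leadingCoeff.totalDegree * 1 :=
        aeval_natDegree_le _ le_rfl _ fun _ => Polynomial.natDegree_X_le
      have h2 := totalDegree_coeff_finSuccEquiv_add_le g p.natDegree
        (Polynomial.leadingCoeff_ne_zero.2 hp0)
      change p.leadingCoeff.totalDegree + _ ≤ _ at h2
      omega
    · have hy' : eval (fun _ => y) p.leadingCoeff ≠ 0 := by
        rw [← hq]
        simpa [hq0] using hy
      have h1 : (p.map (eval fun _ => y)).degree ≠ 0 := by
        rw [Polynomial.degree_map_eq_of_leadingCoeff_ne_zero _ hy', Polynomial.degree_eq_natDegree hp0]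
        exact_mod_cast hdeg
      obtain ⟨x, hx⟩ := IsAlgClosed.exists_root _ h1
      exact ⟨x, by rw [heval]; exact hx⟩

theorem meetsHorizontalLines_zeroLocus {g : MvPolynomial (Fin 2) ℂ} (hg : ∀ c : ℂ, g ≠ C c)
    {e : ℕ} (he : g.totalDegree ≤ e) : MeetsHorizontalLines e {p | eval p g = 0} := by
  rcases exists_eval_eq_zero hg with h | ⟨T, hT, h⟩
  · exact Or.inl h
  · exact Or.inr ⟨T, hT.trans he, h⟩

/-! ### Products of plane sets inside the zero locus -/

/-- The point of the four-dimensional affine space formed by two points of the plane. -/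
def pairPoint {α : Type*} (p q : Fin 2 → α) : Fin 4 → α := ![p 0, p 1, q 0, q 1]

theorem totalDegree_aeval_le_of_le_one {σ τ : Type} (F : MvPolynomial σ ℂ)
    (f : σ → MvPolynomial τ ℂ) (hf : ∀ i, (f i).totalDegree ≤ 1) :
    (aeval f F).totalDegree ≤ F.totalDegree := by
  rw [aeval_def, eval₂_eq]
  refine totalDegree_finsetSum_le fun m hm => ?_
  refine (totalDegree_mul _ _).trans ?_
  rw [algebraMap_eq, totalDegree_C, zero_add]
  refine (totalDegree_finsetProd _ _).trans ?_
  refine le_trans (Finset.sum_le_sum fun i _ => ?_) (le_totalDegree hm)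
  refine (totalDegree_pow _ _).trans ?_
  simpa using Nat.mul_le_mul_left (m i) (hf i)

theorem eval_rename_left (p q : Fin 2 → ℂ) (G : MvPolynomial (Fin 2) ℂ) :
    eval (pairPoint p q) (rename ![0, 1] G) = eval p G := by
  rw [eval_rename]
  congr 2
  ext i
  fin_cases i <;> rfl

theorem eval_rename_right (p q : Fin 2 → ℂ) (H : MvPolynomial (Fin 2) ℂ) :
    eval (pairPoint p q) (rename ![2, 3] H) = eval q H := by
  rw [eval_rename]
  congr 2
  ext i
  fin_cases i <;> rfl

/-- By the Nullstellensatz, the irreducible `h` divides `f`. -/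
theorem totalDegree_le_of_vanishing {σ : Type} [Finite σ] {h f : MvPolynomial σ ℂ}
    (hh : Irreducible h) (hf : f ≠ 0) (hv : ∀ q, eval q h = 0 → eval q f = 0) :
    h.totalDegree ≤ f.totalDegree := by
  have hp : (Ideal.span {h}).IsPrime :=
    (Ideal.span_singleton_prime hh.ne_zero).2 (UniqueFactorizationMonoid.irreducible_iff_prime.1 hh)
  have h1 : f ∈ Ideal.span {h} := by
    rw [← IsPrime.vanishingIdeal_zeroLocus (K := ℂ) (Ideal.span {h})]
    intro q hq
    simpa [aeval_eq_eval] using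
      hv q (by simpa [aeval_eq_eval] using hq h (Ideal.mem_span_singleton_self h))
  obtain ⟨g, rfl⟩ := Ideal.mem_span_singleton.1 h1
  rw [totalDegree_mul_of_isDomain hh.ne_zero (right_ne_zero_of_mul hf)]
  exact Nat.le_add_right _ _

theorem exists_irreducible_dvd {g : MvPolynomial (Fin 2) ℂ} (hg : ∀ c : ℂ, g ≠ C c) :
    ∃ h, Irreducible h ∧ (∀ c : ℂ, h ≠ C c) ∧ h ∣ g := by
  have hu : ¬ IsUnit g := by
    rw [isUnit_iff_eq_C_of_isReduced]
    rintro ⟨r, -, hr⟩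
    exact hg r hr
  obtain ⟨h, hh, hd⟩ := WfDvdMonoid.exists_irreducible_factor hu (by simpa using hg 0)
  refine ⟨h, hh, ?_, hd⟩
  rintro c rfl
  refine hh.not_isUnit (IsUnit.map C (IsUnit.mk0 c ?_))
  rintro rfl
  exact hh.ne_zero (map_zero _)

theorem totalDegree_le_of_vanishing_right {F : MvPolynomial (Fin 4) ℂ}
    {H : MvPolynomial (Fin 2) ℂ} (hH : Irreducible H) {p q₀ : Fin 2 → ℂ}
    (h₀ : eval (pairPoint p q₀) F ≠ 0) (h : ∀ q, eval q H = 0 → eval (pairPoint p q) F = 0) :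
    H.totalDegree ≤ F.totalDegree := by
  let f : MvPolynomial (Fin 2) ℂ := aeval (pairPoint (fun i => C (p i)) X) F
  have hf : ∀ q, eval q f = eval (pairPoint p q) F := by
    intro q
    rw [eval_aeval]
    congr 2
    ext i
    fin_cases i <;> simp [pairPoint]
  refine (totalDegree_le_of_vanishing (f := f) hH ?_ (by simpa only [hf] using h)).trans ?_
  · intro h1
    rw [← hf, h1, map_zero] at h₀
    exact h₀ rfl
  · refine totalDegree_aeval_le_of_le_one _ _ fun i => ?_
    fin_cases i <;> simp [pairPoint]

theorem totalDegree_le_of_vanishing_left {F : MvPolynomial (Fin 4) ℂ}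
    {G : MvPolynomial (Fin 2) ℂ} (hG : Irreducible G) {p₀ q : Fin 2 → ℂ}
    (h₀ : eval (pairPoint p₀ q) F ≠ 0) (h : ∀ p, eval p G = 0 → eval (pairPoint p q) F = 0) :
    G.totalDegree ≤ F.totalDegree := by
  let f : MvPolynomial (Fin 2) ℂ := aeval (pairPoint X fun i => C (q i)) F
  have hf : ∀ p, eval p f = eval (pairPoint p q) F := by
    intro q
    rw [eval_aeval]
    congr 2
    ext i
    fin_cases i <;> simp [pairPoint]
  refine (totalDegree_le_of_vanishing (f := f) hG ?_ (by simpa only [hf] using h)).trans ?_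
  · intro h1
    rw [← hf, h1, map_zero] at h₀
    exact h₀ rfl
  · refine totalDegree_aeval_le_of_le_one _ _ fun i => ?_
    fin_cases i <;> simp [pairPoint]

/-- A Cartesian polynomial vanishes on a product of two plane sets, each of which meets almost all
horizontal lines; the number of exceptional lines is bounded by the degree. -/
theorem IsCartesian.exists_product {F : MvPolynomial (Fin 4) ℂ} (hF : IsCartesian F) {e : ℕ}
    (he : F.totalDegree ≤ e) :
    ∃ K L : Set (Fin 2 → ℂ), MeetsHorizontalLines e K ∧ MeetsHorizontalLines e L ∧
      ∀ p ∈ K, ∀ q ∈ L, eval (pairPoint p q) F = 0 := by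
  obtain ⟨G', H', F₁, F₂, hG', hH', hF'⟩ := hF
  -- The degrees of `G'` and `H'` are unbounded. An irreducible factor divides every slice of `F`
  -- that vanishes on its zero locus, so a nonzero such slice bounds its degree by that of `F`. If
  -- all slices at points of one curve vanish, the other factor is enlarged to the whole plane.
  obtain ⟨G, hGi, hG, hGd⟩ := exists_irreducible_dvd hG'
  obtain ⟨H, hHi, hH, hHd⟩ := exists_irreducible_dvd hH'
  have hGH : ∀ p q, eval p G = 0 → eval q H = 0 → eval (pairPoint p q) F = 0 := by
    intro p q hp hq
    have hp' : eval p G' = 0 := zero_dvd_iff.1 (hp ▸ map_dvd (eval p) hGd)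
    have hq' : eval q H' = 0 := zero_dvd_iff.1 (hq ▸ map_dvd (eval q) hHd)
    rw [hF', map_add, map_mul, map_mul, eval_rename_left, eval_rename_right, hp', hq']
    ring
  by_cases hF0 : ∀ p q, eval (pairPoint p q) F = 0
  · exact ⟨Set.univ, Set.univ, meetsHorizontalLines_univ e, meetsHorizontalLines_univ e,
      fun p _ q _ => hF0 p q⟩
  push Not at hF0
  obtain ⟨p₀, q₀, h₀⟩ := hF0
  by_cases h1 : ∀ p q, eval q H = 0 → eval (pairPoint p q) F = 0
  · exact ⟨Set.univ, {q | eval q H = 0}, meetsHorizontalLines_univ e,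
      meetsHorizontalLines_zeroLocus hH
        ((totalDegree_le_of_vanishing_right hHi h₀ (h1 p₀)).trans he),
      fun p _ q hq => h1 p q hq⟩
  by_cases h2 : ∀ p q, eval p G = 0 → eval (pairPoint p q) F = 0
  · exact ⟨{p | eval p G = 0}, Set.univ, meetsHorizontalLines_zeroLocus hG
        ((totalDegree_le_of_vanishing_left hGi h₀ fun p => h2 p q₀).trans he),
      meetsHorizontalLines_univ e, fun p hp q _ => h2 p q hp⟩
  push Not at h1 h2
  obtain ⟨p₁, q₁, hq₁, hF₁⟩ := h1
  obtain ⟨p₂, q₂, hp₂, hF₂⟩ := h2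
  exact ⟨{p | eval p G = 0}, {q | eval q H = 0},
    meetsHorizontalLines_zeroLocus hG
      ((totalDegree_le_of_vanishing_left hGi hF₁ fun p hp => hGH p q₁ hp hq₁).trans he),
    meetsHorizontalLines_zeroLocus hH
      ((totalDegree_le_of_vanishing_right hHi hF₂ fun q hq => hGH p₂ q hp₂ hq).trans he),
    fun p hp q hq => hGH p q hp hq⟩

/-! ### Parametrized triples of points -/

/-- Three points of the plane which depend polynomially on at most three parameters, and one of
whose coordinates takes three fixed distinct values. -/
structure ParamTriple where
  /-- The number of parameters. -/
  n : ℕ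
  /-- The coordinates of the three points. -/
  pt : Fin 3 → Fin 2 → MvPolynomial (Fin n) ℂ
  /-- The fixed coordinate. -/
  κ : Fin 2
  /-- The values of the fixed coordinate. -/
  ξ : Fin 3 → ℂ
  ξ_injective : Function.Injective ξ
  pt_κ : ∀ i, pt i κ = C (ξ i)
  n_le : n ≤ 3

namespace ParamTriple

/-- The points for the values `s` of the parameters. -/
noncomputable def point (T : ParamTriple) (s : Fin T.n → ℂ) (i : Fin 3) : Fin 2 → ℂ :=
  fun l => eval s (T.pt i l)

/-- The matrix whose determinant vanishes if and only if the three points are collinear. -/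
noncomputable def affineMatrix (T : ParamTriple) (s : Fin T.n → ℂ) : Matrix (Fin 3) (Fin 3) ℂ :=
  Matrix.of fun i => ![1, T.point s i 0, T.point s i 1]

/-- Three points `(0, y), (1, y), (2, y)`, with the parameter `y`. -/
noncomputable def horizontal : ParamTriple where
  n := 1
  pt i := ![C (i : ℕ), X 0]
  κ := 0
  ξ i := (i : ℕ)
  ξ_injective i j h := Fin.ext (Nat.cast_injective h)
  pt_κ _ := rfl
  n_le := by omega

/-- Three points with given second coordinates on a line `x = s₀ + s₁ y`. -/
noncomputable def onLine (y : Fin 3 → ℂ) (hy : Function.Injective y) : ParamTriple where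
  n := 2
  pt i := ![X 0 + X 1 * C (y i), C (y i)]
  κ := 1
  ξ := y
  ξ_injective := hy
  pt_κ _ := rfl
  n_le := by omega

/-- Three points with given second coordinates. -/
noncomputable def general (y : Fin 3 → ℂ) (hy : Function.Injective y) : ParamTriple where
  n := 3
  pt i := ![X i, C (y i)]
  κ := 1
  ξ := y
  ξ_injective := hy
  pt_κ _ := rfl
  n_le := le_rfl

theorem horizontal_point (s : Fin 1 → ℂ) (i : Fin 3) :
    horizontal.point s i = ![((i : ℕ) : ℂ), s 0] := by
  ext l
  fin_cases l
  exacts [eval_C _, eval_X _]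

theorem onLine_point {y : Fin 3 → ℂ} (hy : Function.Injective y) (s : Fin 2 → ℂ) (i : Fin 3) :
    (onLine y hy).point s i = ![s 0 + s 1 * y i, y i] := by
  ext l
  fin_cases l
  · change eval s (X 0 + X 1 * C (y i)) = s 0 + s 1 * y i
    simp
  · exact eval_C _

theorem general_point {y : Fin 3 → ℂ} (hy : Function.Injective y) (s : Fin 3 → ℂ) (i : Fin 3) :
    (general y hy).point s i = ![s i, y i] := by
  ext l
  fin_cases l
  exacts [eval_X _, eval_C _]

end ParamTriple

theorem det_ne_zero_of_not_collinear {x y : Fin 3 → ℂ} (hy : Function.Injective y)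
    (h : ¬ ∃ s₀ s₁ : ℂ, ∀ i, x i = s₀ + s₁ * y i) :
    (Matrix.of fun i => ![1, x i, y i]).det ≠ 0 := by
  intro hdet
  obtain ⟨v, hv, hMv⟩ := Matrix.exists_mulVec_eq_zero_iff.2 hdet
  have h1 : ∀ i, v 0 + v 1 * x i + v 2 * y i = 0 := by
    intro i
    have := congrFun hMv i
    simp only [Matrix.mulVec, dotProduct, Fin.sum_univ_three, Matrix.of_apply, Matrix.cons_val,
      Pi.zero_apply] at this
    linear_combination this
  by_cases hv1 : v 1 = 0
  · have h2 : v 2 = 0 := by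
      have h3 : v 2 * (y 0 - y 1) = 0 := by
        have h0 := h1 0
        have h1 := h1 1
        rw [hv1] at h0 h1
        linear_combination h0 - h1
      exact (mul_eq_zero.1 h3).resolve_right (sub_ne_zero.2 (hy.ne (by decide)))
    refine hv (funext fun i => ?_)
    have h0 := h1 0
    fin_cases i
    · simpa [hv1, h2] using h0
    · exact hv1
    · exact h2
  · refine h ⟨-v 0 / v 1, -v 2 / v 1, fun i => ?_⟩
    field_simp
    linear_combination h1 i

/-- Among the `e + 3` heights 0, …, e + 2 at most `e` are missed, so three remain. Fixing this list
in advance makes `Λ` finite and independent of `K`. -/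
theorem exists_finite_paramTriple (e : ℕ) :
    ∃ (Λ : Type) (_ : Fintype Λ) (T : Λ → ParamTriple), ∀ K, MeetsHorizontalLines e K →
      ∃ l s, (∀ i, (T l).point s i ∈ K) ∧ ((T l).n = 3 → ((T l).affineMatrix s).det ≠ 0) := by
  classical
  have hy : ∀ f : Fin 3 ↪ Fin (e + 3), Function.Injective fun i => ((f i : ℕ) : ℂ) := by
    intro f i j h
    exact f.injective (Fin.ext (Nat.cast_injective h))
  refine ⟨Option (Bool × (Fin 3 ↪ Fin (e + 3))), inferInstance, fun o => o.elim .horizontal fun b =>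
    bif b.1 then .onLine _ (hy b.2) else .general _ (hy b.2), fun K hK => ?_⟩
  rcases hK with ⟨y, hK⟩ | ⟨T, hT, hK⟩
  · refine ⟨none, fun _ => y, fun i => ?_, fun h => absurd h (by decide : ¬ (1 = 3))⟩
    convert hK (i : ℕ) using 1
    exact ParamTriple.horizontal_point _ i
  · let T' : Finset (Fin (e + 3)) := Finset.univ.filter fun i => ((i : ℕ) : ℂ) ∉ T
    have hT' : 3 ≤ T'.card := by
      have h1 : (Finset.univ.filter fun i : Fin (e + 3) => ((i : ℕ) : ℂ) ∈ T).card ≤ T.card :=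
        Finset.card_le_card_of_injOn (fun i => ((i : ℕ) : ℂ)) (fun i hi => by simpa using hi)
          (fun i _ j _ h => Fin.ext (Nat.cast_injective h))
      have h2 := Finset.card_filter_add_card_filter_not (s := (Finset.univ : Finset (Fin (e + 3))))
        (fun i => ((i : ℕ) : ℂ) ∈ T)
      rw [Finset.card_univ, Fintype.card_fin] at h2
      change 3 ≤ (Finset.univ.filter fun i : Fin (e + 3) => ¬ ((i : ℕ) : ℂ) ∈ T).card
      omega
    obtain ⟨g⟩ : Nonempty (Fin 3 ↪ T') := Function.Embedding.nonempty_of_card_le (by simpa using hT')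
    let f : Fin 3 ↪ Fin (e + 3) := g.trans (Function.Embedding.subtype _)
    have hf : ∀ i, ((f i : ℕ) : ℂ) ∉ T := fun i => (Finset.mem_filter.1 (g i).2).2
    choose x hx using fun i => hK _ (hf i)
    by_cases hcol : ∃ s₀ s₁ : ℂ, ∀ i, x i = s₀ + s₁ * ((f i : ℕ) : ℂ)
    · obtain ⟨s₀, s₁, hs⟩ := hcol
      refine ⟨some (true, f), (![s₀, s₁] : Fin 2 → ℂ), fun i => ?_,
        fun h => absurd h (by decide : ¬ (2 = 3))⟩
      convert hx i using 1
      rw [hs]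
      exact ParamTriple.onLine_point (hy f) _ i
    · have hp := ParamTriple.general_point (hy f) x
      refine ⟨some (false, f), x, fun i => ?_, fun _ => ?_⟩
      · convert hx i using 1
        exact hp i
      · have := det_ne_zero_of_not_collinear (hy f) hcol
        convert this using 2
        ext i j
        change ![1, (ParamTriple.general _ (hy f)).point x i 0,
          (ParamTriple.general _ (hy f)).point x i 1] j = _
        rw [hp]
        rfl

/-! ### Independence of the vanishing conditions on grids -/

/-- Polynomials of degree at most two in two variables are determined by their values at six points
of a triangular grid. -/
theorem det_triangular_grid_ne_zero {ξ ζ : Fin 3 → ℂ} (hξ : Function.Injective ξ)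
    (hζ : Function.Injective ζ) :
    (Matrix.of fun k k' : Fin 6 =>
      ξ (![0, 1, 2, 0, 1, 0] k) ^ (![0, 1, 2, 0, 1, 0] k' : ℕ) *
        ζ (![0, 0, 0, 1, 1, 2] k) ^ (![0, 0, 0, 1, 1, 2] k' : ℕ)).det ≠ 0 := by
  intro hdet
  obtain ⟨v, hv, hMv⟩ := Matrix.exists_mulVec_eq_zero_iff.2 hdet
  have h := fun i => congrFun hMv i
  simp only [Matrix.mulVec, dotProduct, Fin.sum_univ_six, Matrix.of_apply, Matrix.cons_val,
      Pi.zero_apply, pow_zero, pow_one, one_mul, mul_one] at h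
  have h0 := h 0
  have h1 := h 1
  have h2 := h 2
  have h3 := h 3
  have h4 := h 4
  have h5 := h 5
  simp only [Matrix.cons_val] at h0 h1 h2 h3 h4 h5
  have a1 : ξ 1 - ξ 0 ≠ 0 := sub_ne_zero.2 (hξ.ne (by decide))
  have a2 : ξ 2 - ξ 0 ≠ 0 := sub_ne_zero.2 (hξ.ne (by decide))
  have a3 : ξ 2 - ξ 1 ≠ 0 := sub_ne_zero.2 (hξ.ne (by decide))
  have b1 : ζ 1 - ζ 0 ≠ 0 := sub_ne_zero.2 (hζ.ne (by decide))
  have b2 : ζ 2 - ζ 0 ≠ 0 := sub_ne_zero.2 (hζ.ne (by decide))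
  have b3 : ζ 2 - ζ 1 ≠ 0 := sub_ne_zero.2 (hζ.ne (by decide))
  -- First and second divided differences along the rows and columns of the grid.
  have e1 : v 1 + v 2 * (ξ 1 + ξ 0) + v 4 * ζ 0 = 0 :=
    mul_left_cancel₀ a1 (by linear_combination h1 - h0)
  have e2 : v 1 + v 2 * (ξ 2 + ξ 0) + v 4 * ζ 0 = 0 :=
    mul_left_cancel₀ a2 (by linear_combination h2 - h0)
  have v2 : v 2 = 0 := mul_left_cancel₀ a3 (by linear_combination e2 - e1)
  have e3 : v 1 + v 2 * (ξ 1 + ξ 0) + v 4 * ζ 1 = 0 :=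
    mul_left_cancel₀ a1 (by linear_combination h4 - h3)
  have v4 : v 4 = 0 := mul_left_cancel₀ b1 (by linear_combination e3 - e1)
  have e4 : v 3 + v 5 * (ζ 1 + ζ 0) + v 4 * ξ 0 = 0 :=
    mul_left_cancel₀ b1 (by linear_combination h3 - h0)
  have e5 : v 3 + v 5 * (ζ 2 + ζ 0) + v 4 * ξ 0 = 0 :=
    mul_left_cancel₀ b2 (by linear_combination h5 - h0)
  have v5 : v 5 = 0 := mul_left_cancel₀ b3 (by linear_combination e5 - e4)
  have v1 : v 1 = 0 := by simpa [v2, v4] using e1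
  have v3 : v 3 = 0 := by simpa [v4, v5] using e4
  have v0 : v 0 = 0 := by simpa [v1, v2, v3, v4, v5] using h0
  refine hv (funext fun i => ?_)
  fin_cases i <;> assumption

/-- The exponent of the product of a monomial in the first two variables and a monomial in the last
two variables. -/
noncomputable def pairExponent {d : ℕ} (m m' : Fin 2 → ℕ) (h : m 0 + m 1 + (m' 0 + m' 1) ≤ d) : CoeffIndex d :=
  ⟨Finsupp.equivFunOnFinite.symm (pairPoint m m'), by
    rw [Finsupp.degree_eq_sum]
    simpa [Fin.sum_univ_four, pairPoint, add_assoc] using h⟩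

theorem prod_pow_pairExponent {d : ℕ} (m m' : Fin 2 → ℕ) (h : m 0 + m 1 + (m' 0 + m' 1) ≤ d)
    (p q : Fin 2 → ℂ) :
    ∏ l, pairPoint p q l ^ (pairExponent m m' h).1 l = (∏ l, p l ^ m l) * ∏ l, q l ^ m' l := by
  simp [Fin.prod_univ_four, Fin.prod_univ_two, pairExponent, pairPoint, mul_assoc]

theorem pairExponent_inj {d : ℕ} {m m' n n' : Fin 2 → ℕ} {h : m 0 + m 1 + (m' 0 + m' 1) ≤ d}
    {h' : n 0 + n 1 + (n' 0 + n' 1) ≤ d} (he : pairExponent m m' h = pairExponent n n' h') :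
    m = n ∧ m' = n' := by
  have h1 : pairPoint m m' = pairPoint n n' :=
    Finsupp.equivFunOnFinite.symm.injective (congrArg Subtype.val he)
  have h2 := fun i => congrFun h1 i
  constructor <;> ext i <;> fin_cases i
  exacts [h2 0, h2 1, h2 2, h2 3]

/-- The coordinates of the pair of points with indices `i` and `j` from two triples, in terms of the
parameters of both. -/
noncomputable def ParamTriple.pair (T T' : ParamTriple) (i j : Fin 3) :
    Fin 4 → MvPolynomial (Fin T.n ⊕ Fin T'.n) ℂ :=
  pairPoint (fun l => rename Sum.inl (T.pt i l)) fun l => rename Sum.inr (T'.pt j l)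

theorem ParamTriple.eval_pair (T T' : ParamTriple) (i j : Fin 3) (s : Fin T.n → ℂ)
    (s' : Fin T'.n → ℂ) (l : Fin 4) :
    eval (Sum.elim s s') (T.pair T' i j l) = pairPoint (T.point s i) (T'.point s' j) l := by
  fin_cases l <;> simp [ParamTriple.pair, pairPoint, eval_rename, ParamTriple.point]

theorem ParamTriple.point_κ (T : ParamTriple) (s : Fin T.n → ℂ) (i : Fin 3) :
    T.point s i T.κ = T.ξ i := by
  simp [ParamTriple.point, T.pt_κ]

theorem prod_pow_single (p : Fin 2 → ℂ) (κ : Fin 2) (a : ℕ) :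
    ∏ l, p l ^ (Pi.single κ a : Fin 2 → ℕ) l = p κ ^ a := by
  rw [Finset.prod_eq_single κ (fun l _ hl => by simp [Pi.single_eq_of_ne hl]) (by simp)]
  simp

theorem single_add_single (κ : Fin 2) (a : ℕ) :
    (Pi.single κ a : Fin 2 → ℕ) 0 + (Pi.single κ a : Fin 2 → ℕ) 1 = a := by
  fin_cases κ <;> simp

theorem exists_relation_of_vanishing_on_grid {d : ℕ} (hd : 2 ≤ d) (T T' : ParamTriple)
    (G : MvPolynomial (Fin 4) ℂ) :
    ∃ Ψ : MvPolynomial (Option (CoeffIndex d)) ℂ, Ψ ≠ 0 ∧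
      ∀ (F : MvPolynomial (Fin 4) ℂ) (a : ℂ) (s : Fin T.n → ℂ) (s' : Fin T'.n → ℂ),
        F.totalDegree ≤ d → (T.n = 3 → (T.affineMatrix s).det ≠ 0) →
        (T'.n = 3 → (T'.affineMatrix s').det ≠ 0) →
        (∀ i j, eval (pairPoint (T.point s i) (T'.point s' j)) (F + C a * G) = 0) →
        eval (fun o => o.elim a (coeffVector d F)) Ψ = 0 := by
  have hn := T.n_le
  have hn' := T'.n_le
  by_cases h3 : T.n = 3 ∧ T'.n = 3
  · let m : Fin 3 → Fin 2 → ℕ := ![![0, 0], ![1, 0], ![0, 1]]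
    have hm : ∀ a, m a 0 + m a 1 ≤ 1 := by decide
    have hminj : Function.Injective m := by decide
    obtain ⟨Ψ, hΨ, h⟩ := exists_relation_of_det_ne_zero (d := d) (ρ := Fin 3 × Fin 3)
      (by simp [h3.1, h3.2])
      (fun k => pairExponent (m k.1) (m k.2) (by have := hm k.1; have := hm k.2; omega))
      (fun k k' hk => Prod.ext (hminj (pairExponent_inj hk).1) (hminj (pairExponent_inj hk).2))
      (fun k => T.pair T' k.1 k.2) G
    refine ⟨Ψ, hΨ, fun F a s s' hF hT hT' hv => h F a (Sum.elim s s') hF ?_ fun k => ?_⟩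
    · simp only [ParamTriple.eval_pair, prod_pow_pairExponent]
      have hA : ∀ (T : ParamTriple) (s : Fin T.n → ℂ) i a,
          ∏ l, T.point s i l ^ m a l = T.affineMatrix s i a := by
        intro T s i a
        fin_cases a <;> simp [m, ParamTriple.affineMatrix, Fin.prod_univ_two]
      simp only [hA]
      have := Matrix.det_kronecker (T.affineMatrix s) (T'.affineMatrix s')
      refine ne_of_eq_of_ne this (mul_ne_zero (pow_ne_zero _ (hT h3.1)) (pow_ne_zero _ (hT' h3.2)))
    · simp only [ParamTriple.eval_pair]
      exact hv k.1 k.2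
  -- At most five parameters remain, so six points suffice. The monomials of degree at most two in
  -- the two fixed coordinates have constant values there, so degenerate triples do no harm.
  · let i : Fin 6 → ℕ := ![0, 1, 2, 0, 1, 0]
    let j : Fin 6 → ℕ := ![0, 0, 0, 1, 1, 2]
    have hij : ∀ k, i k + j k ≤ 2 := by decide
    have hinj : ∀ k k', i k = i k' → j k = j k' → k = k' := by decide
    have hκ : ∀ κ a b, (Pi.single κ a : Fin 2 → ℕ) = Pi.single κ b → a = b :=
      fun κ a b h => by simpa using congrFun h κ
    obtain ⟨Ψ, hΨ, h⟩ := exists_relation_of_det_ne_zero (d := d) (ρ := Fin 6)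
      (by simp only [Fintype.card_sum, Fintype.card_fin]; omega)
      (fun k => pairExponent (Pi.single T.κ (i k)) (Pi.single T'.κ (j k))
        (by have := hij k; rw [single_add_single, single_add_single]; omega))
      (fun k k' hk => hinj k k' (hκ _ _ _ (pairExponent_inj hk).1) (hκ _ _ _ (pairExponent_inj hk).2))
      (fun k => T.pair T' (![0, 1, 2, 0, 1, 0] k) (![0, 0, 0, 1, 1, 2] k)) G
    refine ⟨Ψ, hΨ, fun F a s s' hF _ _ hv => h F a (Sum.elim s s') hF ?_ fun k => ?_⟩
    · simp only [ParamTriple.eval_pair, prod_pow_pairExponent, prod_pow_single, ParamTriple.point_κ]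
      exact det_triangular_grid_ne_zero T.ξ_injective T'.ξ_injective
    · simp only [ParamTriple.eval_pair]
      exact hv _ _

/-! ### From relations to generic finiteness -/

/-- For every `G`, the pairs `(F, a)` for which `F + a G` is Cartesian satisfy a nontrivial
polynomial relation. -/
theorem exists_relation_of_isCartesian {d : ℕ} (hd : 2 ≤ d) (G : MvPolynomial (Fin 4) ℂ) :
    ∃ Ψ : MvPolynomial (Option (CoeffIndex d)) ℂ, Ψ ≠ 0 ∧
      ∀ (F : MvPolynomial (Fin 4) ℂ) (a : ℂ), F.totalDegree ≤ d → IsCartesian (F + C a * G) →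
        eval (fun o => o.elim a (coeffVector d F)) Ψ = 0 := by
  obtain ⟨Λ, _, T, hT⟩ := exists_finite_paramTriple (max d G.totalDegree)
  choose Ψ hΨ h using fun l l' => exists_relation_of_vanishing_on_grid hd (T l) (T l') G
  refine ⟨∏ l, ∏ l', Ψ l l', Finset.prod_ne_zero_iff.2 fun l _ => Finset.prod_ne_zero_iff.2
    fun l' _ => hΨ l l', fun F a hF hC => ?_⟩
  have hdeg : (F + C a * G).totalDegree ≤ max d G.totalDegree := by
    refine (totalDegree_add _ _).trans (max_le_max hF ((totalDegree_mul _ _).trans ?_))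
    simp
  obtain ⟨K, L, hK, hL, hv⟩ := hC.exists_product hdeg
  obtain ⟨l, s, hs, hs'⟩ := hT K hK
  obtain ⟨l', t, ht, ht'⟩ := hT L hL
  simp only [map_prod]
  refine Finset.prod_eq_zero (Finset.mem_univ l) (Finset.prod_eq_zero (Finset.mem_univ l') ?_)
  exact h l l' F a s t hF hs' ht' fun i j => hv _ (hs i) _ (ht j)

theorem exists_coeffVector_eq {d : ℕ} (y : CoeffIndex d → ℂ) :
    ∃ F : MvPolynomial (Fin 4) ℂ, F.totalDegree ≤ d ∧ coeffVector d F = y := by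
  classical
  have hdeg : ∀ m : CoeffIndex d, (monomial m.1 (y m)).totalDegree ≤ d := fun m => by
    refine (totalDegree_monomial_le m.1 (y m)).trans ?_
    have h := m.2
    rwa [Finsupp.degree_apply] at h
  refine ⟨∑ m : CoeffIndex d, monomial m.1 (y m), totalDegree_finsetSum_le fun m _ => hdeg m,
    funext fun m => ?_⟩
  simp only [coeffVector, coeff_sum, coeff_monomial]
  rw [Finset.sum_eq_single m (fun m' _ h => if_neg fun h' => h (Subtype.ext h')) (by simp)]
  simp

theorem holdsGenerically_of_ne_zero {d : ℕ} {Φ : MvPolynomial (CoeffIndex d) ℂ} (hΦ : Φ ≠ 0)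
    {P : MvPolynomial (Fin 4) ℂ → Prop}
    (h : ∀ F, F.totalDegree ≤ d → eval (coeffVector d F) Φ ≠ 0 → P F) : HoldsGenerically d P := by
  refine ⟨{F | F.totalDegree ≤ d ∧ ¬ ∀ Φ' ∈ ({Φ} : Set _), eval (coeffVector d F) Φ' = 0},
    ⟨{Φ}, rfl⟩, ?_, fun F hF => h F hF.1 (by simpa using hF.2)⟩
  obtain ⟨y, hy⟩ : ∃ y, eval y Φ ≠ 0 := by
    by_contra! hy
    exact hΦ (MvPolynomial.funext fun y => by rw [hy, map_zero])
  obtain ⟨F, hF, rfl⟩ := exists_coeffVector_eq y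
  exact ⟨F, hF, by simpa using hy⟩

/-- For every `G`, there is a nonzero polynomial in the coefficients of `F` such that `F + a G` is
Cartesian for only finitely many `a` whenever it does not vanish. -/
theorem exists_discriminant {d : ℕ} (hd : 2 ≤ d) (G : MvPolynomial (Fin 4) ℂ) :
    ∃ Φ : MvPolynomial (CoeffIndex d) ℂ, Φ ≠ 0 ∧
      ∀ F, F.totalDegree ≤ d → eval (coeffVector d F) Φ ≠ 0 →
        {a : ℂ | IsCartesian (F + C a * G)}.Finite := by
  obtain ⟨Ψ, hΨ, h⟩ := exists_relation_of_isCartesian hd G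
  have hp : optionEquivLeft ℂ (CoeffIndex d) Ψ ≠ 0 := by simpa using hΨ
  -- Φ is the leading coefficient of `Ψ` as a polynomial in `a`.
  refine ⟨_, Polynomial.leadingCoeff_ne_zero.2 hp, fun F hF hlead => ?_⟩
  have hq : (optionEquivLeft ℂ (CoeffIndex d) Ψ).map (eval (coeffVector d F)) ≠ 0 := by
    intro h0
    refine hlead ?_
    rw [Polynomial.leadingCoeff, ← Polynomial.coeff_map, h0, Polynomial.coeff_zero]
  refine (Polynomial.finite_setOfPred_isRoot hq).subset fun a ha => ?_
  rw [Set.mem_ofPred_eq, Polynomial.IsRoot, ← optionEquivLeft_elim_eval]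
  exact h F a hF ha

/-- Along the line, Φ is a polynomial in `a` that is nonzero at `a = 0`. -/
theorem finite_setOf_eval_coeffVector_eq_zero {d : ℕ} {Φ : MvPolynomial (CoeffIndex d) ℂ}
    {F : MvPolynomial (Fin 4) ℂ} (hF : eval (coeffVector d F) Φ ≠ 0)
    (G : MvPolynomial (Fin 4) ℂ) :
    {a : ℂ | eval (coeffVector d (F + C a * G)) Φ = 0}.Finite := by
  let q : Polynomial ℂ := aeval (fun m => Polynomial.C (coeffVector d F m) +
    Polynomial.X * Polynomial.C (coeffVector d G m)) Φ
  have hq : ∀ a, q.eval a = eval (coeffVector d (F + C a * G)) Φ := by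
    intro a
    have h : ∀ p : MvPolynomial (CoeffIndex d) ℂ,
        (aeval (fun m => Polynomial.C (coeffVector d F m) +
          Polynomial.X * Polynomial.C (coeffVector d G m)) p : Polynomial ℂ).eval a =
          eval (coeffVector d (F + C a * G)) p := by
      intro p
      induction p using MvPolynomial.induction_on with
      | C c => simp
      | add p q hp hq => rw [map_add, Polynomial.eval_add, hp, hq, map_add]
      | mul_X p i hp =>
        rw [map_mul, Polynomial.eval_mul, hp, map_mul, aeval_X, eval_X]
        simp [coeffVector, coeff_C_mul, mul_comm a]
    exact h Φ
  have hq0 : q ≠ 0 := by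
    intro h
    have := hq 0
    rw [h] at this
    simp at this
    exact hF this.symm
  refine (Polynomial.finite_setOfPred_isRoot hq0).subset fun a ha => ?_
  rw [Set.mem_ofPred_eq, Polynomial.IsRoot, hq]
  exact ha

theorem proposition3p4 (d : ℕ) (hd : 2 ≤ d) :
    HoldsGenerically d (fun F =>
      ¬ IsCartesian F ∧
        ∀ G : MvPolynomial (Fin 4) ℂ, G.totalDegree ≤ d →
          {a : ℂ | IsCartesian (F + MvPolynomial.C a * G)}.Finite) ∧
    ∀ G : MvPolynomial (Fin 4) ℂ,
      HoldsGenerically d (fun F => {a : ℂ | IsCartesian (F + MvPolynomial.C a * G)}.Finite) := by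
  refine ⟨?_, fun G => ?_⟩
  -- For `G = 0` the set of bad `a` is empty or all of ℂ, so finiteness means that `F` is not
  -- Cartesian.
  · obtain ⟨Φ, hΦ, h⟩ := exists_discriminant hd 0
    have hC : ∀ F : MvPolynomial (Fin 4) ℂ, F.totalDegree ≤ d → IsCartesian F →
        eval (coeffVector d F) Φ = 0 := by
      intro F hF hFC
      by_contra hne
      have := h F hF hne
      simp only [mul_zero, add_zero, hFC, Set.ofPred_true] at this
      exact Set.infinite_univ this
    refine holdsGenerically_of_ne_zero hΦ fun F hF hne => ⟨fun h => hne (hC F hF h), fun G hG => ?_⟩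
    refine (finite_setOf_eval_coeffVector_eq_zero hne G).subset fun a ha => hC _ ?_ ha
    refine (totalDegree_add _ _).trans (max_le hF ((totalDegree_mul _ _).trans ?_))
    simpa using hG
  · obtain ⟨Φ, hΦ, h⟩ := exists_discriminant hd G
    exact holdsGenerically_of_ne_zero hΦ h
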